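/- Let $n\ge 0$ and let $\mathbf{E}$ be the set of all linear subspaces of $\mathbb{R}^n$. For $E\in\mathbf{E}$ let $P_E:\mathbb{R}^n\to\mathbb{R}^n$ be the orthogonal projection onto $E$, and equip $\mathbf{E}$ with the coarsest topology making $E\mapsto P_E$ continuous and with its Borel $\sigma$-algebra. For a Borel probability measure $\mu$ on $\mathbb{R}^n$ let $\mu_E$ be its marginal on $E$, i.e. its push-forward under the orthogonal projection $\mathbb{R}^n\to E$. We say that $\mu$ splits along $(E,E^\perp)$ if $\mu=\mu_E\otimes\mu_{E^\perp}$ (identifying $E\times E^\perp$ with $\mathbb{R}^n$ through addition), and that $\mu$ splits with respect to a Borel probability measure $\xi$ on $\mathbf{E}$ if it splits along $(E,E^\perp)$ for $\xi$-a.e. $E$. **Theorem.** Let $\mu$ be a Borel probability measure on $\mathbb{R}^n$ that splits with respect to a Borel probability measure $\xi$ on $\mathbf{E}$, and let $\lambda\ge 0$ be such that, in the sense of the order of self-adjoint operators, $$\int_{\mathbf{E}} P_E\,d\xi(E)\le(1-\lambda)\,\mathrm{id}_{\mathbb{R}^n}.$$ Let $X\sim\mu$ and let $f\in L^2(\mu)$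 be real-valued. Then $E\mapsto\operatorname{Var}(\mathbb{E}[f(X)\mid P_EX])$ and $E\mapsto\mathbb{E}[\operatorname{Var}(f(X)\mid P_EX)]$ are $\xi$-integrable, and $$\int_{\mathbf{E}}\operatorname{Var}\big(\mathbb{E}[f(X)\mid P_EX]\big)\,d\xi(E)\le(1-\lambda)\operatorname{Var}(f(X)).\tag{1}$$ Moreover, if $\lambda>0$, $$\operatorname{Var}(f(X))\le\frac1\lambda\int_{\mathbf{E}}\mathbb{E}\big[\operatorname{Var}(f(X)\mid P_EX)\big]\,d\xi(E).\tag{2}$$ The two inequalities are equivalent: for every constant $c>0$, (1) with $c$ in place of $\lambda$ holds if and only if (2) with $c$ in place of $\lambda$ holds. -/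

import Mathlib

open MeasureTheory ProbabilityTheory
open scoped MeasureTheory ProbabilityTheory

/-- The coarsest topology on the set of all linear subspaces of `ℝⁿ` for which `E ↦ P_E`
(orthogonal projection, as an operator on `ℝⁿ`) is continuous. -/
noncomputable instance subspaceTopology (n : ℕ) :
    TopologicalSpace (Submodule ℝ (EuclideanSpace ℝ (Fin n))) :=
  TopologicalSpace.induced
    (fun E : Submodule ℝ (EuclideanSpace ℝ (Fin n)) => E.starProjection) inferInstance

/-- The Borel σ-algebra on the set of linear subspaces of `ℝⁿ`. -/
noncomputable instance subspaceMeasurableSpace (n : ℕ) :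
    MeasurableSpace (Submodule ℝ (EuclideanSpace ℝ (Fin n))) :=
  borel _

instance subspaceBorelSpace (n : ℕ) :
    BorelSpace (Submodule ℝ (EuclideanSpace ℝ (Fin n))) :=
  ⟨rfl⟩

/-- The marginal `μ_E` of `μ` on `E`: the push-forward by the orthogonal projection `ℝⁿ → E`. -/
noncomputable def marginalOn {n : ℕ} (μ : Measure (EuclideanSpace ℝ (Fin n)))
    (E : Submodule ℝ (EuclideanSpace ℝ (Fin n))) : Measure E :=
  μ.map E.orthogonalProjectionOnto

/-- `μ` splits along `(E, Eᗮ)`: `μ = μ_E ⊗ μ_{Eᗮ}`, where `E × Eᗮ` is identified with `ℝⁿ`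
through `(y, z) ↦ y + z`. -/
def SplitsAlong {n : ℕ} (μ : Measure (EuclideanSpace ℝ (Fin n)))
    (E : Submodule ℝ (EuclideanSpace ℝ (Fin n))) : Prop :=
  μ = ((marginalOn μ E).prod (marginalOn μ Eᗮ)).map
    (fun p : E × Eᗮ => (p.1 : EuclideanSpace ℝ (Fin n)) + (p.2 : EuclideanSpace ℝ (Fin n)))

/-- `μ` splits with respect to `ξ`: it splits along `(E, Eᗮ)` for `ξ`-almost every `E`. -/
def SplitsWrt {n : ℕ} (μ : Measure (EuclideanSpace ℝ (Fin n)))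
    (ξ : Measure (Submodule ℝ (EuclideanSpace ℝ (Fin n)))) : Prop :=
  ∀ᵐ E ∂ξ, SplitsAlong μ E

/-- The operator inequality `∫ P_E dξ(E) ≤ (1 - lam) id` (Loewner order). -/
def FrameBound {n : ℕ} (ξ : Measure (Submodule ℝ (EuclideanSpace ℝ (Fin n)))) (lam : ℝ) : Prop :=
  ∫ E : Submodule ℝ (EuclideanSpace ℝ (Fin n)), E.starProjection ∂ξ ≤
    (1 - lam) • ContinuousLinearMap.id ℝ (EuclideanSpace ℝ (Fin n))

/-- The σ-algebra on `Ω` generated by the random vector `P_E X`. -/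
noncomputable abbrev sigmaProj {n : ℕ} {Ω : Type*} (X : Ω → EuclideanSpace ℝ (Fin n))
    (E : Submodule ℝ (EuclideanSpace ℝ (Fin n))) : MeasurableSpace Ω :=
  MeasurableSpace.comap (fun ω => E.starProjection (X ω)) inferInstance

/-- `Var(𝔼[f(X) | P_E X])`. -/
noncomputable def varCondExp {n : ℕ} {Ω : Type*} [MeasurableSpace Ω] (P : Measure Ω)
    (X : Ω → EuclideanSpace ℝ (Fin n)) (f : EuclideanSpace ℝ (Fin n) → ℝ)
    (E : Submodule ℝ (EuclideanSpace ℝ (Fin n))) : ℝ :=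
  Var[P[fun ω => f (X ω) | sigmaProj X E]; P]

/-- `𝔼[Var(f(X) | P_E X)]`. -/
noncomputable def expCondVar {n : ℕ} {Ω : Type*} [MeasurableSpace Ω] (P : Measure Ω)
    (X : Ω → EuclideanSpace ℝ (Fin n)) (f : EuclideanSpace ℝ (Fin n) → ℝ)
    (E : Submodule ℝ (EuclideanSpace ℝ (Fin n))) : ℝ :=
  ∫ ω, (Var[fun ω' => f (X ω'); P | sigmaProj X E]) ω ∂P

/-! Let `T` be the `ξ`-average of the conditional expectations given `P_E`, a symmetric operator on
`L²(μ)`. Conditional expectations are orthogonal projections, so (1) says that `⟨T f, f⟩ ≤ (1 - lam)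
‖f‖²` for centered `f`; the law of total variance gives the rest.

For symmetric `T` the sequence `‖T ^ k f‖` is logarithmically convex, so a decay `‖T ^ k f‖ ≤ C (1 -
lam) ^ k` with any constant `C` already implies `‖T f‖ ≤ (1 - lam) ‖f‖`
(`norm_apply_le_of_iterate_decay`). Such decay is proved on two orthogonal pieces of `L²(μ)`.

On test functions orthogonal to affine functions, correlations with waves of frequency `u` are
`O(‖u‖²)`. By splitting, conditioning replaces `u` by `P_E u`, and averaging `‖P_E u‖²` gains the
factor `1 - lam` (`WaveBound.average`). Fourier inversion turns this into decay in `L²`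
(`norm_average_test_le`).

The orthogonal complement of these functions consists of affine functions. On its centered elements
`T` acts through `∫ P_E dξ` on the vector of coefficients (`norm_average_centeredProj_le`). -/

/-! ### Symmetric operators and weak averages. -/

theorem ContinuousLinearMap.pow_succ_apply' {H : Type*} [NormedAddCommGroup H] [NormedSpace ℝ H]
    (T : H →L[ℝ] H) (k : ℕ) (x : H) : (T ^ (k + 1)) x = T ((T ^ k) x) := by
  rw [pow_succ']
  rfl

theorem ContinuousLinearMap.inner_pow_left_of_symmetric {H : Type*} [NormedAddCommGroup H]
    [InnerProductSpace ℝ H] (T : H →L[ℝ] H) (hT : ∀ x y, inner ℝ (T x) y = inner ℝ x (T y))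
    (k : ℕ) (x y : H) : inner ℝ ((T ^ k) x) y = inner ℝ x ((T ^ k) y) := by
  induction k generalizing x y with
  | zero => simp
  | succ k ih =>
    rw [T.pow_succ_apply' k x, hT, ih, pow_succ]
    rfl

/-- A symmetric operator whose iterates at `f` decay like `r ^ k` contracts `f` by the factor `r`:
the sequence `‖T ^ k f‖` is logarithmically convex. -/
theorem norm_apply_le_of_iterate_decay {H : Type*} [NormedAddCommGroup H] [InnerProductSpace ℝ H]
    (T : H →L[ℝ] H) (hT : ∀ x y, inner ℝ (T x) y = inner ℝ x (T y)) {r : ℝ} (hr : 0 ≤ r)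
    (f : H) (A : ℝ) (hA : ∀ k : ℕ, ‖(T ^ k) f‖ ^ 2 ≤ A * (r ^ k) ^ 2) :
    ‖T f‖ ≤ r * ‖f‖ := by
  set b : ℕ → ℝ := fun k => ‖(T ^ k) f‖ with hb
  have hb0 : ∀ k, 0 ≤ b k := fun k => norm_nonneg _
  have hconv : ∀ k, b (k + 1) ^ 2 ≤ b k * b (k + 2) := fun k => by
    have : inner ℝ ((T ^ (k + 1)) f) ((T ^ (k + 1)) f)
        = inner ℝ ((T ^ k) f) ((T ^ (k + 2)) f) := by
      rw [T.pow_succ_apply' (k + 1), T.pow_succ_apply' k, hT]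
    simp only [hb]
    rw [← real_inner_self_eq_norm_sq, this]
    exact real_inner_le_norm _ _
  have h1 : ‖T f‖ = b 1 := by simp [hb]
  have h0 : ‖f‖ = b 0 := by simp [hb]
  rw [h1, h0]
  by_contra! hlt
  have hb0pos : 0 < b 0 := by
    rcases (hb0 0).lt_or_eq with h | h
    · exact h
    · exfalso
      have hf : f = 0 := by rw [← norm_eq_zero, h0, ← h]
      simp [hb, hf] at hlt
  -- Log-convexity makes the successive ratios of `b` nondecreasing, so a first ratio `q > r` forces
  -- growth at least like `q ^ k`, which no constant `A` can absorb.
  obtain ⟨q, hq⟩ : ∃ q, q = b 1 / b 0 := ⟨_, rfl⟩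
  have hqb : q * b 0 = b 1 := by rw [hq]; field_simp
  have hrq : r < q := by rw [hq, lt_div_iff₀ hb0pos]; exact hlt
  have hqpos : 0 < q := hr.trans_lt hrq
  have hstep : ∀ k, 0 < b k ∧ q * b k ≤ b (k + 1) := by
    intro k
    induction k with
    | zero => exact ⟨hb0pos, hqb.le⟩
    | succ k ih =>
      have hpos : 0 < b (k + 1) := (mul_pos hqpos ih.1).trans_le ih.2
      refine ⟨hpos, ?_⟩
      have h2 := hconv k
      have : q * b (k + 1) * b k ≤ b (k + 2) * b k := by nlinarith [ih.2]
      exact le_of_mul_le_mul_right this ih.1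
  have hgrow : ∀ k, q ^ k * b 0 ≤ b k := by
    intro k
    induction k with
    | zero => simp
    | succ k ih =>
      calc q ^ (k + 1) * b 0 = q * (q ^ k * b 0) := by ring
        _ ≤ q * b k := by gcongr
        _ ≤ b (k + 1) := (hstep k).2
  have hfin : ∀ k, (q ^ k * b 0) ^ 2 ≤ A * (r ^ k) ^ 2 := fun k =>
    (pow_le_pow_left₀ (by positivity) (hgrow k) 2).trans (hA k)
  rcases hr.lt_or_eq with hrpos | hr0
  · have hx : 1 < (q / r) ^ 2 := one_lt_pow₀ ((one_lt_div hrpos).2 hrq) two_ne_zero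
    obtain ⟨k, hk⟩ := pow_unbounded_of_one_lt (A / b 0 ^ 2) hx
    rw [div_lt_iff₀ (by positivity)] at hk
    have h3 := hfin k
    have : ((q / r) ^ 2) ^ k * b 0 ^ 2 * (r ^ k) ^ 2 ≤ A * (r ^ k) ^ 2 := by
      refine le_trans (le_of_eq ?_) h3
      rw [← pow_mul, div_pow, pow_mul', pow_mul']
      field_simp
    have := le_of_mul_le_mul_right this (by positivity)
    linarith
  -- For `r = 0` the bound at `k = 1` already forces `q * b 0` to vanish.
  · have h3 := hfin 1
    rw [← hr0] at h3
    have : 0 < (q ^ 1 * b 0) ^ 2 := by positivity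
    simp at h3
    rcases h3 with h | h
    · exact hqpos.ne' h
    · exact hb0pos.ne' h

/-- The weak average of a measurable family of contractions. -/
theorem exists_weak_average {H α : Type*} [NormedAddCommGroup H] [InnerProductSpace ℝ H]
    [CompleteSpace H] [MeasurableSpace α] (ξ : Measure α) [IsProbabilityMeasure ξ]
    (Q : α → H →L[ℝ] H) (hQ : ∀ a x, ‖Q a x‖ ≤ ‖x‖)
    (hmeas : ∀ x y, AEStronglyMeasurable (fun a => inner ℝ (Q a x) y) ξ) :
    (∀ x y, Integrable (fun a => inner ℝ (Q a x) y) ξ) ∧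
    ∃ T : H →L[ℝ] H, ∀ x y, inner ℝ (T x) y = ∫ a, inner ℝ (Q a x) y ∂ξ := by
  have hbound : ∀ x y a, ‖(inner ℝ (Q a x) y : ℝ)‖ ≤ ‖x‖ * ‖y‖ := fun x y a =>
    (norm_inner_le_norm _ _).trans (mul_le_mul_of_nonneg_right (hQ a x) (norm_nonneg _))
  have hint : ∀ x y, Integrable (fun a => inner ℝ (Q a x) y) ξ := fun x y =>
    Integrable.of_bound (hmeas x y) (‖x‖ * ‖y‖) (Filter.Eventually.of_forall (hbound x y))
  refine ⟨hint, ?_⟩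
  let B : H →ₗ[ℝ] H →ₗ[ℝ] ℝ := LinearMap.mk₂ ℝ (fun x y => ∫ a, inner ℝ (Q a x) y ∂ξ)
    (fun x x' y => by
      simp only [map_add, inner_add_left]
      exact integral_add (hint x y) (hint x' y))
    (fun c x y => by
      simp only [map_smul, real_inner_smul_left, smul_eq_mul]
      exact integral_const_mul _ _)
    (fun x y y' => by
      simp only [inner_add_right]
      exact integral_add (hint x y) (hint x y'))
    (fun c x y => by
      simp only [real_inner_smul_right, smul_eq_mul]
      exact integral_const_mul _ _)
  let B' : H →L[ℝ] H →L[ℝ] ℝ := B.mkContinuous₂ 1 (fun x y => by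
    refine (norm_integral_le_of_norm_le_const (Filter.Eventually.of_forall (hbound x y))).trans ?_
    simp)
  refine ⟨InnerProductSpace.continuousLinearMapOfBilin (𝕜 := ℝ) B', fun x y => ?_⟩
  rw [InnerProductSpace.continuousLinearMapOfBilin_apply]
  rfl

/-! ### Conditioning on `P_E` and splitting. -/

/-- Transfers conditioning from `Ω` to the law of `X`, so that the analysis takes place in `L²(μ)`.
-/
theorem condExp_comp_ae_eq {Ω S : Type*} [MeasurableSpace Ω]
    (m : MeasurableSpace S) {mS : MeasurableSpace S}
    (P : Measure Ω) [IsProbabilityMeasure P] {X : Ω → S} (hX : Measurable X)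
    (hm : m ≤ mS) {f : S → ℝ} (hf : Integrable f (P.map X)) :
    P[fun ω => f (X ω) | m.comap X] =ᵐ[P] fun ω => ((P.map X)[f | m]) (X ω) := by
  have : IsProbabilityMeasure (P.map X) := Measure.isProbabilityMeasure_map hX.aemeasurable
  have hle : m.comap X ≤ ‹MeasurableSpace Ω› :=
    (MeasurableSpace.comap_mono hm).trans hX.comap_le
  symm
  refine ae_eq_condExp_of_forall_setIntegral_eq hle (hf.comp_measurable hX) ?_ ?_ ?_
  · intro s _ _
    exact (integrable_condExp.comp_measurable hX).integrableOn
  · rintro s ⟨t, ht, rfl⟩ _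
    rw [← setIntegral_map (hm t ht) integrable_condExp.aestronglyMeasurable hX.aemeasurable,
      ← setIntegral_map (hm t ht) hf.aestronglyMeasurable hX.aemeasurable,
      setIntegral_condExp hm hf ht]
  · exact (stronglyMeasurable_condExp.comp_measurable
      (comap_measurable X)).aestronglyMeasurable

/-- The point with `E`-component taken from `x` and `Eᗮ`-component taken from `y`. -/
noncomputable def mixProj {n : ℕ} (E : Submodule ℝ (EuclideanSpace ℝ (Fin n)))
    (x y : EuclideanSpace ℝ (Fin n)) : EuclideanSpace ℝ (Fin n) :=
  E.starProjection x + (y - E.starProjection y)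

theorem starProjection_mixProj {n : ℕ} (E : Submodule ℝ (EuclideanSpace ℝ (Fin n)))
    (x y : EuclideanSpace ℝ (Fin n)) :
    E.starProjection (mixProj E x y) = E.starProjection x := by
  have h : ∀ z, E.starProjection (E.starProjection z) = E.starProjection z := fun z =>
    Submodule.starProjection_eq_self_iff.2 (Submodule.starProjection_apply_mem E z)
  simp [mixProj, h]

theorem inner_mixProj {n : ℕ} (E : Submodule ℝ (EuclideanSpace ℝ (Fin n)))
    (u x y : EuclideanSpace ℝ (Fin n)) :
    inner ℝ u (mixProj E x y)
      = inner ℝ (E.starProjection u) x + inner ℝ (u - E.starProjection u) y := by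
  simp only [mixProj, inner_add_right, inner_sub_right, inner_sub_left]
  rw [E.inner_starProjection_left_eq_right u x, E.inner_starProjection_left_eq_right u y]

theorem continuous_starProjection_family (n : ℕ) :
    Continuous (fun E : Submodule ℝ (EuclideanSpace ℝ (Fin n)) => E.starProjection) :=
  continuous_induced_dom

theorem continuous_starProjection_apply {n : ℕ} (x : EuclideanSpace ℝ (Fin n)) :
    Continuous (fun E : Submodule ℝ (EuclideanSpace ℝ (Fin n)) => E.starProjection x) :=
  (continuous_starProjection_family n).clm_apply continuous_const

theorem continuous_mixProj_family {n : ℕ} (x y : EuclideanSpace ℝ (Fin n)) :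
    Continuous (fun E => mixProj E x y) :=
  (continuous_starProjection_apply x).add
    (continuous_const.sub (continuous_starProjection_apply y))

theorem continuous_mixProj {n : ℕ} (E : Submodule ℝ (EuclideanSpace ℝ (Fin n))) :
    Continuous (fun p : EuclideanSpace ℝ (Fin n) × EuclideanSpace ℝ (Fin n) =>
      mixProj E p.1 p.2) := by
  unfold mixProj
  fun_prop

/-- Dominated convergence with parameter `E` needs sequential continuity to suffice. -/
instance subspaceFirstCountable (n : ℕ) :
    FirstCountableTopology (Submodule ℝ (EuclideanSpace ℝ (Fin n))) :=
  TopologicalSpace.firstCountableTopology_induced _ _ _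

theorem sigmaProj_id_le {n : ℕ} (E : Submodule ℝ (EuclideanSpace ℝ (Fin n))) :
    sigmaProj id E ≤ (inferInstance : MeasurableSpace (EuclideanSpace ℝ (Fin n))) :=
  Measurable.comap_le (by fun_prop)

/-- The conditional expectation given `P_E`, as an operator on `L²(μ)`. -/
noncomputable def condProj {n : ℕ} (μ : Measure (EuclideanSpace ℝ (Fin n)))
    (E : Submodule ℝ (EuclideanSpace ℝ (Fin n))) : Lp ℝ 2 μ →L[ℝ] Lp ℝ 2 μ :=
  (lpMeas ℝ ℝ (sigmaProj id E) 2 μ).subtypeL ∘L condExpL2 ℝ ℝ (sigmaProj_id_le E)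

theorem norm_condProj_apply_le {n : ℕ} {μ : Measure (EuclideanSpace ℝ (Fin n))}
    (E : Submodule ℝ (EuclideanSpace ℝ (Fin n))) (f : Lp ℝ 2 μ) :
    ‖condProj μ E f‖ ≤ ‖f‖ :=
  norm_condExpL2_coe_le (𝕜 := ℝ) (sigmaProj_id_le E) f

theorem inner_condProj_left {n : ℕ} {μ : Measure (EuclideanSpace ℝ (Fin n))}
    (E : Submodule ℝ (EuclideanSpace ℝ (Fin n))) (f g : Lp ℝ 2 μ) :
    inner ℝ (condProj μ E f) g = inner ℝ f (condProj μ E g) :=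
  inner_condExpL2_left_eq_right (𝕜 := ℝ) (sigmaProj_id_le E)

theorem inner_condProj_self {n : ℕ} {μ : Measure (EuclideanSpace ℝ (Fin n))}
    (E : Submodule ℝ (EuclideanSpace ℝ (Fin n))) (f : Lp ℝ 2 μ) :
    inner ℝ (condProj μ E f) f = ‖condProj μ E f‖ ^ 2 := by
  rw [← real_inner_self_eq_norm_sq]
  exact (inner_condExpL2_eq_inner_fun (𝕜 := ℝ) (sigmaProj_id_le E) f (condProj μ E f)
    (aestronglyMeasurable_condExpL2 (𝕜 := ℝ) (sigmaProj_id_le E) f)).symm ▸ real_inner_comm _ _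

section Splitting

variable {n : ℕ} {μ : Measure (EuclideanSpace ℝ (Fin n))} [IsProbabilityMeasure μ]
  {E : Submodule ℝ (EuclideanSpace ℝ (Fin n))}

/-- Splitting in usable form: recombining the components of two independent copies gives back the
law `μ`. -/
theorem SplitsAlong.measurePreserving_mixProj (h : SplitsAlong μ E) :
    MeasurePreserving (fun p : EuclideanSpace ℝ (Fin n) × EuclideanSpace ℝ (Fin n) =>
      mixProj E p.1 p.2) (μ.prod μ) μ := by
  refine ⟨(continuous_mixProj E).measurable, ?_⟩
  unfold SplitsAlong marginalOn at h
  rw [Measure.map_prod_map _ _ (by fun_prop) (by fun_prop), Measure.map_map (by fun_prop)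
    (by fun_prop)] at h
  conv_rhs => rw [h]
  congr 1
  ext1 p
  simp only [mixProj, Function.comp, Prod.map]
  congr 1
  exact (Submodule.starProjection_orthogonal_val p.2).symm

/-- If `μ` splits along `(E, Eᗮ)`, conditioning on `P_E` is integrating out the
`Eᗮ`-component. -/
theorem SplitsAlong.condExp_ae_eq (h : SplitsAlong μ E) {f : EuclideanSpace ℝ (Fin n) → ℝ}
    (hf : Integrable f μ) :
    μ[f | sigmaProj id E] =ᵐ[μ] fun x => ∫ y, f (mixProj E x y) ∂μ := by
  have hmp := h.measurePreserving_mixProj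
  have hfi : Integrable (fun p : EuclideanSpace ℝ (Fin n) × EuclideanSpace ℝ (Fin n) =>
      f (mixProj E p.1 p.2)) (μ.prod μ) := hmp.integrable_comp_of_integrable hf
  symm
  refine ae_eq_condExp_of_forall_setIntegral_eq (sigmaProj_id_le E) hf ?_ ?_ ?_
  · intro s _ _
    exact hfi.integral_prod_left.integrableOn
  · intro s hs _
    have hs' : MeasurableSet s := sigmaProj_id_le E s hs
    -- Events generated by `P_E` do not see the `Eᗮ`-component, so the indicator passes inside the
    -- integral.
    have hmem : ∀ x y, mixProj E x y ∈ s ↔ x ∈ s := by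
      obtain ⟨t, -, rfl⟩ := hs
      intro x y
      simp [starProjection_mixProj]
    have hint : Integrable (fun p : EuclideanSpace ℝ (Fin n) × EuclideanSpace ℝ (Fin n) =>
        s.indicator f (mixProj E p.1 p.2)) (μ.prod μ) :=
      hmp.integrable_comp_of_integrable (hf.indicator hs')
    calc ∫ x in s, ∫ y, f (mixProj E x y) ∂μ ∂μ
        = ∫ x, ∫ y, s.indicator f (mixProj E x y) ∂μ ∂μ := by
          rw [← integral_indicator hs']
          congr 1
          ext1 x
          by_cases hx : x ∈ s
          · simp [Set.indicator, hx, hmem]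
          · simp [Set.indicator, hx, hmem]
      _ = ∫ p, s.indicator f (mixProj E p.1 p.2) ∂(μ.prod μ) := (integral_prod _ hint).symm
      _ = ∫ x, s.indicator f x ∂μ := by
          rw [← integral_map hmp.aemeasurable, hmp.map_eq]
          rw [hmp.map_eq]
          exact (hf.indicator hs').aestronglyMeasurable
      _ = ∫ x in s, f x ∂μ := integral_indicator hs'
  -- With a strongly measurable version of `f`, the inner integral is exactly, not just almost
  -- everywhere, a function of `P_E x`.
  · obtain ⟨f', hf', hff'⟩ := hf.aestronglyMeasurable
    have hG : StronglyMeasurable (fun x => ∫ y, f' (mixProj E x y) ∂μ) :=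
      StronglyMeasurable.integral_prod_right (f := fun x y => f' (mixProj E x y))
        (hf'.comp_measurable (continuous_mixProj E).measurable)
    refine ⟨fun x => ∫ y, f' (mixProj E x y) ∂μ, ?_, ?_⟩
    · have h2 : (fun x => ∫ y, f' (mixProj E x y) ∂μ)
          = (fun x => ∫ y, f' (mixProj E x y) ∂μ) ∘ fun x => E.starProjection (id x) := by
        ext1 x
        have h : ∀ z, E.starProjection (E.starProjection z) = E.starProjection z := fun z =>
          Submodule.starProjection_eq_self_iff.2 (Submodule.starProjection_apply_mem E z)
        simp [mixProj, h]
      rw [h2]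
      exact hG.comp_measurable (comap_measurable _)
    · have h3 := hmp.quasiMeasurePreserving.ae_eq_comp hff'
      filter_upwards [Measure.ae_ae_of_ae_prod h3] with x hx
      exact integral_congr_ae hx

theorem condProj_toLp_ae_eq (E : Submodule ℝ (EuclideanSpace ℝ (Fin n)))
    {f : EuclideanSpace ℝ (Fin n) → ℝ} (hf : MemLp f 2 μ) :
    condProj μ E (hf.toLp f) =ᵐ[μ] μ[f | sigmaProj id E] :=
  hf.condExpL2_ae_eq_condExp (𝕜 := ℝ) (sigmaProj_id_le E)

theorem SplitsAlong.condProj_ae_eq (h : SplitsAlong μ E)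
    {f : EuclideanSpace ℝ (Fin n) → ℝ} (hf : MemLp f 2 μ) :
    condProj μ E (hf.toLp f) =ᵐ[μ] fun x => ∫ y, f (mixProj E x y) ∂μ :=
  (condProj_toLp_ae_eq E hf).trans (h.condExp_ae_eq (hf.integrable one_le_two))

theorem inner_toLp_eq_integral {α : Type*} [MeasurableSpace α] {ν : Measure α} (h : Lp ℝ 2 ν)
    {f : α → ℝ} (hf : MemLp f 2 ν) : inner ℝ h (hf.toLp f) = ∫ x, h x * f x ∂ν := by
  rw [L2.inner_def]
  refine integral_congr_ae ?_
  filter_upwards [hf.coeFn_toLp] with x hx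
  simp [hx, mul_comm]

theorem SplitsAlong.inner_condProj_toLp (h : SplitsAlong μ E) (g : Lp ℝ 2 μ)
    {f : EuclideanSpace ℝ (Fin n) → ℝ} (hf : MemLp f 2 μ) :
    inner ℝ (condProj μ E (hf.toLp f)) g = ∫ x, g x * ∫ y, f (mixProj E x y) ∂μ ∂μ := by
  rw [L2.inner_def]
  refine integral_congr_ae ?_
  filter_upwards [h.condProj_ae_eq hf] with x hx
  simp [hx]

end Splitting

/-- For bounded continuous `f` the splitting formula holds for `ξ`-a.e. `E`, and its right side is
continuous in `E`. Density in `L²(μ)` and pointwise limits give the general case. -/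
theorem aestronglyMeasurable_inner_condProj {n : ℕ} {μ : Measure (EuclideanSpace ℝ (Fin n))}
    [IsProbabilityMeasure μ] {ξ : Measure (Submodule ℝ (EuclideanSpace ℝ (Fin n)))}
    (hsplit : SplitsWrt μ ξ) (f g : Lp ℝ 2 μ) :
    AEStronglyMeasurable (fun E => inner ℝ (condProj μ E f) g) ξ := by
  have hdense := BoundedContinuousFunction.toLp_denseRange (p := 2) ℝ μ ℝ ENNReal.ofNat_ne_top
  refine hdense.induction_on (p := fun f => AEStronglyMeasurable
    (fun E => inner ℝ (condProj μ E f) g) ξ) f ?_ ?_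
  · refine IsSeqClosed.isClosed fun a b ha hab => ?_
    refine aestronglyMeasurable_of_tendsto_ae Filter.atTop (fun k => ha k)
      (Filter.Eventually.of_forall fun E => ?_)
    exact (((condProj μ E).continuous.inner continuous_const).tendsto b).comp hab
  · intro a
    have hmem : MemLp a 2 μ := MemLp.of_bound a.continuous.aestronglyMeasurable ‖a‖
      (Filter.Eventually.of_forall a.norm_coe_le_norm)
    have hcont : Continuous fun E => ∫ x, g x * ∫ y, a (mixProj E x y) ∂μ ∂μ := by
      have hgi : Integrable g μ := (Lp.memLp g).integrable one_le_two
      refine continuous_of_dominated (bound := fun x => ‖g x‖ * ‖a‖) ?_ ?_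
        (hgi.norm.mul_const _) ?_
      · intro E
        refine hgi.aestronglyMeasurable.mul ?_
        exact (StronglyMeasurable.integral_prod_right (f := fun x y => a (mixProj E x y))
          ((a.continuous.comp (continuous_mixProj E)).stronglyMeasurable)).aestronglyMeasurable
      · intro E
        refine Filter.Eventually.of_forall fun x => ?_
        rw [norm_mul]
        gcongr
        refine (norm_integral_le_of_norm_le_const
          (Filter.Eventually.of_forall fun y => a.norm_coe_le_norm _)).trans ?_
        simp
      · refine Filter.Eventually.of_forall fun x => continuous_const.mul ?_
        refine continuous_of_dominated (bound := fun _ => ‖a‖) ?_ ?_ (integrable_const _) ?_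
        · intro E
          exact (a.continuous.comp ((continuous_mixProj E).comp
            (Continuous.prodMk_right x))).aestronglyMeasurable
        · intro E
          exact Filter.Eventually.of_forall fun y => a.norm_coe_le_norm _
        · exact Filter.Eventually.of_forall fun y =>
            a.continuous.comp (continuous_mixProj_family x y)
    refine hcont.aestronglyMeasurable.congr ?_
    filter_upwards [hsplit] with E hE
    rw [← hE.inner_condProj_toLp g hmem]
    rfl

/-! ### The averaged projection on Euclidean space. -/

section Frame

variable {n : ℕ} {ξ : Measure (Submodule ℝ (EuclideanSpace ℝ (Fin n)))} [IsProbabilityMeasure ξ]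

theorem integrable_starProjection :
    Integrable (fun E : Submodule ℝ (EuclideanSpace ℝ (Fin n)) => E.starProjection) ξ :=
  Integrable.of_bound (continuous_starProjection_family n).aestronglyMeasurable 1
    (Filter.Eventually.of_forall fun E => Submodule.starProjection_norm_le E)

theorem inner_integral_starProjection (u w : EuclideanSpace ℝ (Fin n)) :
    inner ℝ ((∫ E : Submodule ℝ (EuclideanSpace ℝ (Fin n)), E.starProjection ∂ξ) u) w
      = ∫ E : Submodule ℝ (EuclideanSpace ℝ (Fin n)), inner ℝ (E.starProjection u) w ∂ξ := by
  rw [ContinuousLinearMap.integral_apply integrable_starProjection, real_inner_comm,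
    ← integral_inner (integrable_starProjection.apply_continuousLinearMap u)]
  simp only [real_inner_comm]

theorem inner_starProjection_self (E : Submodule ℝ (EuclideanSpace ℝ (Fin n)))
    (u : EuclideanSpace ℝ (Fin n)) : inner ℝ (E.starProjection u) u = ‖E.starProjection u‖ ^ 2 := by
  rw [← real_inner_self_eq_norm_sq, E.inner_starProjection_left_eq_right u (E.starProjection u),
    Submodule.starProjection_eq_self_iff.2 (Submodule.starProjection_apply_mem E u),
    real_inner_comm]

theorem integrable_norm_starProjection_sq (u : EuclideanSpace ℝ (Fin n)) :
    Integrable (fun E : Submodule ℝ (EuclideanSpace ℝ (Fin n)) => ‖E.starProjection u‖ ^ 2) ξ := by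
  refine Integrable.of_bound
    ((continuous_starProjection_apply u).norm.pow 2).aestronglyMeasurable (‖u‖ ^ 2)
    (Filter.Eventually.of_forall fun E => ?_)
  rw [Real.norm_of_nonneg (by positivity)]
  gcongr
  exact Submodule.norm_starProjection_apply_le E u

variable {lam : ℝ}

theorem FrameBound.integral_norm_sq_le (h : FrameBound ξ lam) (u : EuclideanSpace ℝ (Fin n)) :
    ∫ E : Submodule ℝ (EuclideanSpace ℝ (Fin n)), ‖E.starProjection u‖ ^ 2 ∂ξ
      ≤ (1 - lam) * ‖u‖ ^ 2 := by
  have h1 := (ContinuousLinearMap.le_def _ _).1 h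
  have h2 := h1.inner_nonneg_left u
  simp only [_root_.sub_apply, _root_.smul_apply,
    ContinuousLinearMap.id_apply, inner_sub_left, real_inner_smul_left,
    real_inner_self_eq_norm_sq, inner_integral_starProjection, inner_starProjection_self] at h2
  linarith

/-- The form bound controls the norm because the operator is an average of projections: `⟨P_E w, z⟩
= ⟨P_E w, P_E z⟩` and the arithmetic-geometric mean inequality bound the bilinear form by its
diagonal. -/
theorem FrameBound.norm_integral_apply_le (h : FrameBound ξ lam) (hr : 0 ≤ 1 - lam)
    (u : EuclideanSpace ℝ (Fin n)) :
    ‖(∫ E : Submodule ℝ (EuclideanSpace ℝ (Fin n)), E.starProjection ∂ξ) u‖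
      ≤ (1 - lam) * ‖u‖ := by
  set A := ∫ E : Submodule ℝ (EuclideanSpace ℝ (Fin n)), E.starProjection ∂ξ with hA
  have key : ∀ w z, inner ℝ (A w) z ≤ (1 - lam) * (‖w‖ ^ 2 + ‖z‖ ^ 2) / 2 := by
    intro w z
    rw [hA, inner_integral_starProjection]
    have h1 := h.integral_norm_sq_le w
    have h2 := h.integral_norm_sq_le z
    calc ∫ E : Submodule ℝ (EuclideanSpace ℝ (Fin n)), inner ℝ (E.starProjection w) z ∂ξ
        ≤ ∫ E : Submodule ℝ (EuclideanSpace ℝ (Fin n)),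
            (‖E.starProjection w‖ ^ 2 + ‖E.starProjection z‖ ^ 2) / 2 ∂ξ := by
          refine integral_mono
            ((integrable_starProjection.apply_continuousLinearMap w).inner_const z)
            (((integrable_norm_starProjection_sq w).add
              (integrable_norm_starProjection_sq z)).div_const 2) fun E => ?_
          have h3 : inner ℝ (E.starProjection w) z
              = inner ℝ (E.starProjection w) (E.starProjection z) := by
            rw [← E.inner_starProjection_left_eq_right,
              Submodule.starProjection_eq_self_iff.2 (Submodule.starProjection_apply_mem E w)]
          have h4 := real_inner_le_norm (E.starProjection w) (E.starProjection z)
          simp only [h3]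
          nlinarith [sq_nonneg (‖E.starProjection w‖ - ‖E.starProjection z‖)]
      _ ≤ (1 - lam) * (‖w‖ ^ 2 + ‖z‖ ^ 2) / 2 := by
          rw [integral_div, integral_add (integrable_norm_starProjection_sq w)
            (integrable_norm_starProjection_sq z)]
          linarith
  rcases eq_or_ne (A u) 0 with h0 | h0
  · rw [h0, norm_zero]; positivity
  have hpos : 0 < ‖A u‖ := norm_pos_iff.2 h0
  -- `A u` rescaled to norm `‖u‖` balances the two squares in `key`.
  have h1 := key u ((‖u‖ / ‖A u‖) • A u)
  rw [real_inner_smul_right, real_inner_self_eq_norm_sq, norm_smul, Real.norm_of_nonneg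
    (by positivity), div_mul_cancel₀ _ hpos.ne', pow_two ‖A u‖, ← mul_assoc,
    div_mul_cancel₀ _ hpos.ne'] at h1
  have hu : 0 < ‖u‖ := norm_pos_iff.2 fun hu => h0 (by rw [hu, map_zero])
  refine le_of_mul_le_mul_left ?_ hu
  linarith

end Frame

/-! ### Plane waves and decay of correlations. -/

/-- The plane wave with frequency `u` and phase `θ`. -/
noncomputable def wave {n : ℕ} (u : EuclideanSpace ℝ (Fin n)) (θ : ℝ)
    (x : EuclideanSpace ℝ (Fin n)) : ℝ :=
  Real.cos (inner ℝ u x + θ)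

theorem continuous_wave {n : ℕ} (u : EuclideanSpace ℝ (Fin n)) (θ : ℝ) :
    Continuous (wave u θ) := by
  unfold wave; fun_prop

theorem abs_wave_le_one {n : ℕ} (u : EuclideanSpace ℝ (Fin n)) (θ : ℝ)
    (x : EuclideanSpace ℝ (Fin n)) : |wave u θ x| ≤ 1 :=
  Real.abs_cos_le_one _

theorem memLp_wave {n : ℕ} (μ : Measure (EuclideanSpace ℝ (Fin n))) [IsFiniteMeasure μ]
    (u : EuclideanSpace ℝ (Fin n)) (θ : ℝ) : MemLp (wave u θ) 2 μ :=
  MemLp.of_bound (continuous_wave u θ).aestronglyMeasurable 1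
    (Filter.Eventually.of_forall (abs_wave_le_one u θ))

/-- `h` correlates with each wave of frequency `u` by at most `K ‖u‖²`. -/
def WaveBound {n : ℕ} {μ : Measure (EuclideanSpace ℝ (Fin n))} [IsFiniteMeasure μ]
    (h : Lp ℝ 2 μ) (K : ℝ) : Prop :=
  ∀ u θ, |∫ x, h x * wave u θ x ∂μ| ≤ K * ‖u‖ ^ 2

/-- Fixing the `Eᗮ`-component turns a wave of frequency `u` into one of frequency `P_E u` with
shifted phase. Conditioning thus mixes phases, which is harmless since `WaveBound` is uniform in
`θ`. -/
theorem WaveBound.condProj {n : ℕ} {μ : Measure (EuclideanSpace ℝ (Fin n))}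
    [IsProbabilityMeasure μ] {E : Submodule ℝ (EuclideanSpace ℝ (Fin n))} {h : Lp ℝ 2 μ} {K : ℝ}
    (hK : WaveBound h K) (hE : SplitsAlong μ E) (u : EuclideanSpace ℝ (Fin n)) (θ : ℝ) :
    |inner ℝ (condProj μ E h) ((memLp_wave μ u θ).toLp _)| ≤ K * ‖E.starProjection u‖ ^ 2 := by
  rw [inner_condProj_left, real_inner_comm, hE.inner_condProj_toLp]
  have hmix : ∀ x y, wave u θ (mixProj E x y)
      = wave (E.starProjection u) (inner ℝ (u - E.starProjection u) y + θ) x := fun x y => by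
    simp only [wave, inner_mixProj]
    ring_nf
  have hhi : Integrable h μ := (Lp.memLp h).integrable one_le_two
  have hint : Integrable (fun p : EuclideanSpace ℝ (Fin n) × EuclideanSpace ℝ (Fin n) =>
      h p.1 * wave u θ (mixProj E p.1 p.2)) (μ.prod μ) := by
    refine (hhi.comp_fst μ).mul_bdd (c := 1)
      ((continuous_wave u θ).comp (continuous_mixProj E)).aestronglyMeasurable
      (Filter.Eventually.of_forall fun p => abs_wave_le_one _ _ _)
  have hswap : ∫ x, h x * ∫ y, wave u θ (mixProj E x y) ∂μ ∂μ
      = ∫ y, ∫ x, h x * wave u θ (mixProj E x y) ∂μ ∂μ := by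
    rw [← integral_integral_swap hint]
    simp only [integral_const_mul]
  rw [hswap, ← Real.norm_eq_abs]
  refine (norm_integral_le_of_norm_le_const (C := K * ‖E.starProjection u‖ ^ 2)
    (Filter.Eventually.of_forall fun y => ?_)).trans (by simp)
  simp only [hmix]
  exact hK _ _

/-- The quadratic weight `‖u‖²` is what the frame bound contracts: the average of `‖P_E u‖²` is at
most `(1 - lam) ‖u‖²`. -/
theorem WaveBound.average {n : ℕ} {μ : Measure (EuclideanSpace ℝ (Fin n))}
    [IsProbabilityMeasure μ] {ξ : Measure (Submodule ℝ (EuclideanSpace ℝ (Fin n)))}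
    [IsProbabilityMeasure ξ] {lam : ℝ} (hframe : FrameBound ξ lam) (hsplit : SplitsWrt μ ξ)
    {T : Lp ℝ 2 μ →L[ℝ] Lp ℝ 2 μ}
    (hT : ∀ f g, inner ℝ (T f) g = ∫ E, inner ℝ (_root_.condProj μ E f) g ∂ξ)
    {h : Lp ℝ 2 μ} {K : ℝ} (hK0 : 0 ≤ K) (hK : WaveBound h K) :
    WaveBound (T h) ((1 - lam) * K) := by
  intro u θ
  rw [← inner_toLp_eq_integral (T h) (memLp_wave μ u θ), hT, ← Real.norm_eq_abs]
  calc _ ≤ ∫ E : Submodule ℝ (EuclideanSpace ℝ (Fin n)), K * ‖E.starProjection u‖ ^ 2 ∂ξ := by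
        refine norm_integral_le_of_norm_le ((integrable_norm_starProjection_sq u).const_mul K) ?_
        filter_upwards [hsplit] with E hE
        exact hK.condProj hE u θ
    _ ≤ (1 - lam) * K * ‖u‖ ^ 2 := by
        rw [integral_const_mul]
        nlinarith [mul_le_mul_of_nonneg_left (hframe.integral_norm_sq_le u) hK0]

theorem abs_sin_sub_self_le (t : ℝ) : |Real.sin t - t| ≤ t ^ 2 := by
  have key : ∀ s : ℝ, 0 ≤ s → |Real.sin s - s| ≤ s ^ 2 := fun s hs => by
    rw [abs_le]
    have h1 := Real.sin_le hs
    have h2 := Real.sin_ge_sub_cube hs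
    have h3 := Real.neg_one_le_sin s
    refine ⟨?_, by nlinarith⟩
    -- The cubic lower bound for the sine suffices up to `6`; beyond, `-1 ≤ sin s` does.
    rcases le_total s 6 with h | h
    · nlinarith [mul_nonneg (sq_nonneg s) (sub_nonneg.2 h)]
    · nlinarith
  rcases le_total 0 t with h | h
  · exact key t h
  · have := key (-t) (neg_nonneg.2 h)
    rw [Real.sin_neg, ← abs_neg] at this
    simpa [add_comm, sub_eq_add_neg] using this

theorem abs_cos_add_sub_le (t θ : ℝ) :
    |Real.cos (t + θ) - (Real.cos θ - t * Real.sin θ)| ≤ 2 * t ^ 2 := by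
  have h1 : |Real.cos t - 1| ≤ t ^ 2 := by
    rw [abs_le]
    constructor <;> nlinarith [Real.cos_le_one t, Real.one_sub_sq_div_two_le_cos (x := t)]
  have h2 := abs_sin_sub_self_le t
  have h3 : Real.cos (t + θ) - (Real.cos θ - t * Real.sin θ)
      = Real.cos θ * (Real.cos t - 1) - Real.sin θ * (Real.sin t - t) := by
    rw [Real.cos_add]; ring
  rw [h3]
  refine (abs_sub _ _).trans ?_
  rw [abs_mul, abs_mul]
  have h4 := mul_le_mul (Real.abs_cos_le_one θ) h1 (abs_nonneg _) zero_le_one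
  have h5 := mul_le_mul (Real.abs_sin_le_one θ) h2 (abs_nonneg _) zero_le_one
  linarith

open scoped ContDiff FourierTransform in
/-- Fourier inversion: a test function is a superposition of waves whose amplitude has a
finite second moment. -/
theorem exists_wave_representation {n : ℕ} {f : EuclideanSpace ℝ (Fin n) → ℝ}
    (hf : ContDiff ℝ ∞ f) (hfc : HasCompactSupport f) :
    ∃ ρ θ : EuclideanSpace ℝ (Fin n) → ℝ, Measurable ρ ∧ Measurable θ ∧ (∀ u, 0 ≤ ρ u) ∧
      Integrable ρ ∧ Integrable (fun u => ‖u‖ ^ 2 * ρ u) ∧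
      ∀ x, f x = ∫ u, ρ u * wave ((2 * Real.pi) • u) (θ u) x := by
  have hc : HasCompactSupport (fun x => (f x : ℂ)) :=
    hfc.comp_left (g := fun t : ℝ => (t : ℂ)) Complex.ofReal_zero
  let F := hc.toSchwartzMap (Complex.ofRealCLM.contDiff.comp hf)
  have hFx : ∀ x, F x = (f x : ℂ) := fun x => rfl
  let G := 𝓕 F
  have hinv : ∀ x, (f x : ℂ) = ∫ u, Complex.exp (((2 * Real.pi * inner ℝ u x : ℝ) : ℂ) * Complex.I)
      • G u := fun x => by
    have h1 : 𝓕⁻ (𝓕 (F : EuclideanSpace ℝ (Fin n) → ℂ)) = F :=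
      F.continuous.fourierInv_fourier_eq F.integrable (𝓕 F).integrable
    rw [← hFx, ← h1, Real.fourierInv_eq']
    rfl
  -- Polar form of the Fourier transform: modulus as amplitude, argument as phase. Since `f` is
  -- real, the real part of the inversion formula loses nothing.
  refine ⟨fun u => ‖G u‖, fun u => (G u).arg, G.continuous.norm.measurable,
    G.continuous.measurable.carg, fun u => norm_nonneg _, G.integrable.norm,
    G.integrable_pow_mul volume 2, fun x => ?_⟩
  have hint : Integrable fun u =>
      Complex.exp (((2 * Real.pi * inner ℝ u x : ℝ) : ℂ) * Complex.I) • G u := by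
    refine G.integrable.norm.mono' (by fun_prop) (Filter.Eventually.of_forall fun u => ?_)
    rw [norm_smul, Complex.norm_exp_ofReal_mul_I, one_mul]
  have h2 := congrArg Complex.re (hinv x)
  rw [Complex.ofReal_re] at h2
  rw [h2, ← RCLike.re_eq_complex_re, ← integral_re hint]
  congr 1
  ext1 u
  conv_lhs => rw [← Complex.norm_mul_exp_arg_mul_I (G u)]
  have h3 : Complex.exp (((2 * Real.pi * inner ℝ u x : ℝ) : ℂ) * Complex.I)
      • ((‖G u‖ : ℂ) * Complex.exp ((G u).arg * Complex.I))
      = (‖G u‖ : ℂ) * Complex.exp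
        (((2 * Real.pi * inner ℝ u x + (G u).arg : ℝ) : ℂ) * Complex.I) := by
    rw [smul_eq_mul, mul_left_comm, ← Complex.exp_add]
    push_cast
    ring_nf
  rw [h3, RCLike.re_eq_complex_re, Complex.re_ofReal_mul, Complex.exp_ofReal_mul_I_re, wave,
    real_inner_smul_left]

theorem memLp_of_hasCompactSupport {n : ℕ} {f : EuclideanSpace ℝ (Fin n) → ℝ}
    (hf : Continuous f) (hfc : HasCompactSupport f) (μ : Measure (EuclideanSpace ℝ (Fin n)))
    [IsFiniteMeasure μ] : MemLp f 2 μ := by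
  obtain ⟨C, hC⟩ := hfc.exists_bound_of_continuous hf
  exact MemLp.of_bound hf.aestronglyMeasurable C (Filter.Eventually.of_forall hC)

open scoped ContDiff in
-- `A` is the second moment of the Fourier amplitude of `f`, up to `(2π)²`. It does not depend on
-- `h`, so it serves all iterates of `T` at once.
theorem exists_inner_le_of_waveBound {n : ℕ} {f : EuclideanSpace ℝ (Fin n) → ℝ}
    (hf : ContDiff ℝ ∞ f) (hfc : HasCompactSupport f) (μ : Measure (EuclideanSpace ℝ (Fin n)))
    [IsProbabilityMeasure μ] :
    ∃ A : ℝ, ∀ (h : Lp ℝ 2 μ) (K : ℝ), WaveBound h K → ∫ x, h x * f x ∂μ ≤ A * K := by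
  obtain ⟨ρ, θ, hρ, hθ, hρ0, hρi, hρ2, hrep⟩ := exists_wave_representation hf hfc
  refine ⟨∫ u, (2 * Real.pi) ^ 2 * (‖u‖ ^ 2 * ρ u), fun h K hK => ?_⟩
  have hhi : Integrable h μ := (Lp.memLp h).integrable one_le_two
  have hint : Integrable (fun p : EuclideanSpace ℝ (Fin n) × EuclideanSpace ℝ (Fin n) =>
      h p.1 * (ρ p.2 * wave ((2 * Real.pi) • p.2) (θ p.2) p.1)) (μ.prod volume) := by
    have h1 := hhi.mul_prod hρi
    have h2 := h1.mul_bdd (c := 1) (g := fun p : EuclideanSpace ℝ (Fin n) ×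
        EuclideanSpace ℝ (Fin n) => wave ((2 * Real.pi) • p.2) (θ p.2) p.1) ?_
      (Filter.Eventually.of_forall fun p => abs_wave_le_one _ _ _)
    · exact h2.congr (Filter.Eventually.of_forall fun p => by ring)
    · refine Measurable.aestronglyMeasurable ?_
      unfold wave
      fun_prop
  calc ∫ x, h x * f x ∂μ
      = ∫ x, (∫ u, h x * (ρ u * wave ((2 * Real.pi) • u) (θ u) x)) ∂μ := by
        simp only [integral_const_mul, ← hrep]
    _ = ∫ u, ∫ x, h x * (ρ u * wave ((2 * Real.pi) • u) (θ u) x) ∂μ :=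
        integral_integral_swap hint
    _ = ∫ u, ρ u * ∫ x, h x * wave ((2 * Real.pi) • u) (θ u) x ∂μ := by
        congr 1
        ext1 u
        rw [← integral_const_mul]
        congr 1
        ext1 x
        ring
    _ ≤ ∫ u, ((2 * Real.pi) ^ 2 * (‖u‖ ^ 2 * ρ u)) * K := by
        refine integral_mono ?_ ((hρ2.const_mul _).mul_const K) fun u => ?_
        · have := hint.integral_prod_right
          refine this.congr (Filter.Eventually.of_forall fun u => ?_)
          simp only [← integral_const_mul]
          congr 1
          ext1 x
          ring
        · have h1 := (le_abs_self _).trans (hK ((2 * Real.pi) • u) (θ u))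
          rw [norm_smul, Real.norm_of_nonneg (by positivity), mul_pow] at h1
          refine (mul_le_mul_of_nonneg_left h1 (hρ0 u)).trans (le_of_eq ?_)
          ring
    _ = (∫ u, (2 * Real.pi) ^ 2 * (‖u‖ ^ 2 * ρ u)) * K := integral_mul_const _ _

/-- The first-order Taylor polynomial of a wave is affine in `x`, hence invisible to `f`. The
remainder is quadratic in `u`, and compact support replaces moment assumptions on `μ`. -/
theorem exists_waveBound_toLp {n : ℕ} {f : EuclideanSpace ℝ (Fin n) → ℝ}
    (hf : Continuous f) (hfc : HasCompactSupport f) (μ : Measure (EuclideanSpace ℝ (Fin n)))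
    [IsProbabilityMeasure μ] (h0 : ∫ x, f x ∂μ = 0)
    (h1 : ∀ v, ∫ x, f x * inner ℝ v x ∂μ = 0) :
    ∃ K, 0 ≤ K ∧ WaveBound ((memLp_of_hasCompactSupport hf hfc μ).toLp f) K := by
  have hcs : ∀ {g : EuclideanSpace ℝ (Fin n) → ℝ}, Continuous g →
      Integrable (fun x => f x * g x) μ := fun hg =>
    (hf.mul hg).integrable_of_hasCompactSupport hfc.mul_right
  refine ⟨∫ x, |f x| * (2 * ‖x‖ ^ 2) ∂μ, integral_nonneg fun x => by positivity, fun u θ => ?_⟩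
  have hlin : ∫ x, f x * (Real.cos θ - inner ℝ u x * Real.sin θ) ∂μ = 0 := by
    have h2 : ∀ x, f x * (Real.cos θ - inner ℝ u x * Real.sin θ)
        = f x * Real.cos θ - f x * inner ℝ u x * Real.sin θ := fun x => by ring
    simp only [h2]
    rw [integral_sub (hcs continuous_const) ((hcs (by fun_prop)).mul_const _),
      integral_mul_const, integral_mul_const, h0, h1]
    simp
  have heq : ∫ x, (memLp_of_hasCompactSupport hf hfc μ).toLp f x * wave u θ x ∂μ
      = ∫ x, f x * (wave u θ x - (Real.cos θ - inner ℝ u x * Real.sin θ)) ∂μ := by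
    simp only [mul_sub (f _) (wave u θ _)]
    rw [integral_sub (hcs (continuous_wave u θ)) (hcs (by fun_prop)), hlin, sub_zero]
    refine integral_congr_ae ?_
    filter_upwards [(memLp_of_hasCompactSupport hf hfc μ).coeFn_toLp] with x hx
    rw [hx]
  rw [heq, ← Real.norm_eq_abs, ← integral_mul_const]
  refine norm_integral_le_of_norm_le ?_ (Filter.Eventually.of_forall fun x => ?_)
  · refine Integrable.mul_const ?_ _
    exact ((hf.abs).mul (by fun_prop)).integrable_of_hasCompactSupport
      (HasCompactSupport.mul_right hfc.norm)
  · rw [Real.norm_eq_abs, abs_mul, mul_assoc]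
    gcongr
    refine (abs_cos_add_sub_le _ _).trans ?_
    have h3 : inner ℝ u x ^ 2 ≤ (‖u‖ * ‖x‖) ^ 2 :=
      sq_le_sq' (abs_le.1 (abs_real_inner_le_norm u x)).1 (real_inner_le_norm u x)
    nlinarith

/-! ### Test functions orthogonal to affine functions. -/

open scoped ContDiff in
/-- Smooth compactly supported functions. -/
def testSpace (n : ℕ) : Submodule ℝ (EuclideanSpace ℝ (Fin n) → ℝ) where
  carrier := {f | ContDiff ℝ ∞ f ∧ HasCompactSupport f}
  add_mem' ha hb := ⟨ha.1.add hb.1, ha.2.add hb.2⟩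
  zero_mem' := ⟨contDiff_const, HasCompactSupport.zero⟩
  smul_mem' _ _ hf := ⟨contDiff_const.smul hf.1, hf.2.smul_left⟩

section Test

variable {n : ℕ} (μ : Measure (EuclideanSpace ℝ (Fin n))) [IsProbabilityMeasure μ]

theorem memLp_testSpace (f : testSpace n) : MemLp f.1 2 μ :=
  memLp_of_hasCompactSupport f.2.1.continuous f.2.2 μ

/-- Test functions as elements of `L²(μ)`. -/
noncomputable def testToLp : testSpace n →ₗ[ℝ] Lp ℝ 2 μ where
  toFun f := (memLp_testSpace μ f).toLp f.1
  map_add' _ _ := rfl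
  map_smul' _ _ := rfl

theorem integrable_testSpace_mul (f : testSpace n) {w : EuclideanSpace ℝ (Fin n) → ℝ}
    (hw : Continuous w) : Integrable (fun x => f.1 x * w x) μ :=
  (f.2.1.continuous.mul hw).integrable_of_hasCompactSupport f.2.2.mul_right

/-- Integration of test functions against a continuous weight. -/
noncomputable def testPairing (w : C(EuclideanSpace ℝ (Fin n), ℝ)) : testSpace n →ₗ[ℝ] ℝ where
  toFun f := ∫ x, f.1 x * w x ∂μ
  map_add' f g := by
    rw [← integral_add (integrable_testSpace_mul μ f w.continuous)
      (integrable_testSpace_mul μ g w.continuous)]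
    congr 1
    ext1 x
    exact add_mul _ _ _
  map_smul' c f := by
    rw [RingHom.id_apply, smul_eq_mul, ← integral_const_mul]
    congr 1
    ext1 x
    exact mul_assoc _ _ _

/-- The weights `1, x₁, …, xₙ`. -/
def affineWeight (n : ℕ) : Option (Fin n) → C(EuclideanSpace ℝ (Fin n), ℝ)
  | none => 1
  | some i => ⟨fun x => x i, by fun_prop⟩

/-- The test functions orthogonal to the affine functions, in `L²(μ)`. -/
noncomputable def affineFreeTest : Submodule ℝ (Lp ℝ 2 μ) :=
  (⨅ o, (testPairing μ (affineWeight n o)).ker).map (testToLp μ)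

variable {μ}

theorem exists_test_of_mem_affineFreeTest {f : Lp ℝ 2 μ} (hf : f ∈ affineFreeTest μ) :
    ∃ g : testSpace n, testToLp μ g = f ∧ ∫ x, g.1 x ∂μ = 0 ∧
      ∀ v, ∫ x, g.1 x * inner ℝ v x ∂μ = 0 := by
  obtain ⟨g, hg, rfl⟩ := hf
  have hg' : ∀ o, testPairing μ (affineWeight n o) g = 0 := by
    simpa [Submodule.mem_iInf] using hg
  refine ⟨g, rfl, by simpa [testPairing, affineWeight] using hg' none, fun v => ?_⟩
  have h1 : ∀ x, g.1 x * inner ℝ v x = ∑ i, v i * (g.1 x * x i) := fun x => by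
    rw [PiLp.inner_apply, Finset.mul_sum]
    refine Finset.sum_congr rfl fun i _ => ?_
    simp only [RCLike.inner_apply, conj_trivial]
    ring
  simp only [h1]
  rw [integral_finsetSum _ fun i _ =>
    (integrable_testSpace_mul μ g (w := fun x => x i) (by fun_prop)).const_mul _]
  refine Finset.sum_eq_zero fun i _ => ?_
  rw [integral_const_mul]
  have h2 : ∫ x, g.1 x * x i ∂μ = 0 := hg' (some i)
  rw [h2, mul_zero]

/-- Pairing with `h` vanishes on the common kernel of finitely many functionals, hence is a
combination of them. So `h` and an affine function agree against every test function. -/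
theorem ae_eq_affine_of_mem_orthogonal {h : Lp ℝ 2 μ} (hh : h ∈ (affineFreeTest μ)ᗮ) :
    ∃ (c : ℝ) (v : EuclideanSpace ℝ (Fin n)), h =ᵐ[μ] fun x => c + inner ℝ v x := by
  let ψ : testSpace n →ₗ[ℝ] ℝ := (innerSL ℝ h).toLinearMap ∘ₗ testToLp μ
  have hψ : ∀ g, ψ g = ∫ x, h x * g.1 x ∂μ := fun g =>
    inner_toLp_eq_integral h (memLp_testSpace μ g)
  have hker : ⨅ o, (testPairing μ (affineWeight n o)).ker ≤ ψ.ker := fun g hg => by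
    have := (Submodule.mem_orthogonal' _ _).1 hh _ (Submodule.mem_map_of_mem hg)
    exact this
  obtain ⟨a, ha⟩ := (Submodule.mem_span_range_iff_exists_fun ℝ).1 (mem_span_of_iInf_ker_le_ker hker)
  refine ⟨a none, WithLp.toLp 2 fun i => a (some i), ?_⟩
  have hhi : Integrable h μ := (Lp.memLp h).integrable one_le_two
  let w : EuclideanSpace ℝ (Fin n) → ℝ := fun x => ∑ o, a o * affineWeight n o x
  have hw : Continuous w := by fun_prop
  have hwx : ∀ x, w x = a none + inner ℝ (WithLp.toLp 2 fun i => a (some i)) x := fun x => by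
    simp only [w, Fintype.sum_option, affineWeight, PiLp.inner_apply, RCLike.inner_apply,
      conj_trivial, ContinuousMap.one_apply, one_mul, ContinuousMap.coe_mk, mul_comm]
  have hz : ∀ᵐ x ∂μ, h x - w x = 0 := by
    refine ae_eq_zero_of_integral_contDiff_smul_eq_zero
      (hhi.locallyIntegrable.sub hw.locallyIntegrable) fun g hg hgc => ?_
    let G : testSpace n := ⟨g, hg, hgc⟩
    have h1 : ψ G = ∑ o, a o * ∫ x, g x * affineWeight n o x ∂μ := by
      rw [← ha]
      simp [testPairing, G]
    rw [hψ] at h1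
    have h2 : ∫ x, g x * w x ∂μ = ∑ o, a o * ∫ x, g x * affineWeight n o x ∂μ := by
      simp only [← integral_const_mul]
      rw [← integral_finsetSum _ fun o _ =>
        (integrable_testSpace_mul μ G (affineWeight n o).continuous).const_mul _]
      congr 1
      ext1 x
      simp only [w, Finset.mul_sum]
      exact Finset.sum_congr rfl fun o _ => by ring
    obtain ⟨C, hC⟩ := hgc.exists_bound_of_continuous hg.continuous
    have h3 : Integrable (fun x => h x * g x) μ :=
      hhi.mul_bdd hg.continuous.aestronglyMeasurable (Filter.Eventually.of_forall hC)
    calc ∫ x, g x • (h x - w x) ∂μ = ∫ x, (h x * g x - g x * w x) ∂μ := by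
          congr 1
          ext1 x
          rw [smul_eq_mul]
          ring
      _ = 0 := by
          rw [integral_sub h3 (integrable_testSpace_mul μ G hw), h2]
          exact sub_eq_zero.2 h1
  filter_upwards [hz] with x hx
  rw [← hwx]
  linarith

end Test

/-! ### Square-integrable linear functionals. -/

section Linear

variable {n : ℕ} (μ : Measure (EuclideanSpace ℝ (Fin n))) [IsProbabilityMeasure μ]

/-- The vectors `v` for which `⟨v, ·⟩` is square integrable. -/
def linSpace {n : ℕ} (μ : Measure (EuclideanSpace ℝ (Fin n))) :
    Submodule ℝ (EuclideanSpace ℝ (Fin n)) where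
  carrier := {v | MemLp (fun x => inner ℝ v x) 2 μ}
  add_mem' {a b} ha hb := by
    simp only [Set.mem_ofPred_eq, inner_add_left] at *
    exact ha.add hb
  zero_mem' := by simp
  smul_mem' c v hv := by
    simp only [Set.mem_ofPred_eq, real_inner_smul_left] at *
    exact hv.const_mul c

theorem memLp_centered (v : linSpace μ) :
    MemLp (fun x => inner ℝ v.1 x - ∫ y, inner ℝ v.1 y ∂μ) 2 μ :=
  MemLp.sub v.2 (memLp_const _)

/-- The centered linear functionals in `L²(μ)`. -/
noncomputable def centeredLin : linSpace μ →ₗ[ℝ] Lp ℝ 2 μ where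
  toFun v := (memLp_centered μ v).toLp _
  map_add' v w := by
    rw [← MemLp.toLp_add, MemLp.toLp_eq_toLp_iff]
    refine Filter.Eventually.of_forall fun x => ?_
    have hv : Integrable (fun y => inner ℝ v.1 y) μ := MemLp.integrable one_le_two v.2
    have hw : Integrable (fun y => inner ℝ w.1 y) μ := MemLp.integrable one_le_two w.2
    simp only [Submodule.coe_add, inner_add_left, Pi.add_apply]
    rw [integral_add hv hw]
    ring
  map_smul' c v := by
    rw [RingHom.id_apply, ← MemLp.toLp_const_smul, MemLp.toLp_eq_toLp_iff]
    refine Filter.Eventually.of_forall fun x => ?_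
    simp only [Submodule.coe_smul, real_inner_smul_left, Pi.smul_apply, smul_eq_mul]
    rw [integral_const_mul]
    ring

/-- `centeredLin`, extended to all vectors by projecting to `linSpace μ`. -/
noncomputable def centeredProj : EuclideanSpace ℝ (Fin n) →L[ℝ] Lp ℝ 2 μ :=
  (LinearMap.toContinuousLinearMap (centeredLin μ)) ∘L (linSpace μ).orthogonalProjectionOnto

theorem centeredProj_coe (v : linSpace μ) : centeredProj μ v = centeredLin μ v := by
  simp [centeredProj]

theorem centeredProj_starProjection (w : EuclideanSpace ℝ (Fin n)) :
    centeredProj μ ((linSpace μ).starProjection w) = centeredProj μ w := by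
  rw [Submodule.starProjection_apply, centeredProj_coe]
  rfl

variable {μ}

theorem centeredProj_mem_orthogonal (w : EuclideanSpace ℝ (Fin n)) :
    centeredProj μ w ∈ (affineFreeTest μ)ᗮ := by
  rw [← centeredProj_starProjection, Submodule.starProjection_apply, centeredProj_coe]
  set v := (linSpace μ).orthogonalProjectionOnto w
  refine (Submodule.mem_orthogonal _ _).2 fun f hf => ?_
  obtain ⟨g, rfl, h0, h1⟩ := exists_test_of_mem_affineFreeTest hf
  have h2 : inner ℝ (testToLp μ g) (centeredLin μ v)
      = ∫ x, (g.1 x * inner ℝ v.1 x - g.1 x * ∫ y, inner ℝ v.1 y ∂μ) ∂μ := by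
    refine (inner_toLp_eq_integral _ (memLp_centered μ v)).trans (integral_congr_ae ?_)
    filter_upwards [(memLp_testSpace μ g).coeFn_toLp] with x hx
    rw [← mul_sub]
    exact congrArg (· * _) hx
  rw [h2, integral_sub (integrable_testSpace_mul μ g (by fun_prop))
    (integrable_testSpace_mul μ g continuous_const), h1, integral_mul_const, h0]
  simp

/-- By Fubini, `y ↦ ⟨v, mixProj E x y⟩` is square integrable for some fixed `x`, and up to a
constant it is the functional of `v - P_E v`. -/
theorem SplitsAlong.starProjection_mem_linSpace {E : Submodule ℝ (EuclideanSpace ℝ (Fin n))}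
    (hE : SplitsAlong μ E) {v : EuclideanSpace ℝ (Fin n)} (hv : v ∈ linSpace μ) :
    E.starProjection v ∈ linSpace μ := by
  have h1 : MemLp ((fun x => inner ℝ v x) ∘ fun p : EuclideanSpace ℝ (Fin n) ×
      EuclideanSpace ℝ (Fin n) => mixProj E p.1 p.2) 2 (μ.prod μ) :=
    MemLp.comp_measurePreserving hv hE.measurePreserving_mixProj
  obtain ⟨x, hx⟩ := h1.integrable_sq.prod_right_ae.exists
  have h2 : MemLp (fun y => inner ℝ v (mixProj E x y)) 2 μ := by
    refine (memLp_two_iff_integrable_sq ?_).2 hx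
    exact (Continuous.inner continuous_const ((continuous_mixProj E).comp
      (Continuous.prodMk_right x))).aestronglyMeasurable
  have h3 : MemLp (fun y => inner ℝ (v - E.starProjection v) y) 2 μ := by
    refine (h2.sub (memLp_const (inner ℝ (E.starProjection v) x))).ae_eq
      (Filter.Eventually.of_forall fun y => ?_)
    simp [inner_mixProj]
  have h4 : v - E.starProjection v ∈ linSpace μ := h3
  simpa using (linSpace μ).sub_mem hv h4

theorem SplitsAlong.condProj_centeredLin {E : Submodule ℝ (EuclideanSpace ℝ (Fin n))}
    (hE : SplitsAlong μ E) (v : linSpace μ) :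
    condProj μ E (centeredLin μ v) = centeredProj μ (E.starProjection v.1) := by
  have hmem := hE.starProjection_mem_linSpace v.2
  rw [centeredProj_coe μ ⟨_, hmem⟩]
  apply Lp.ext
  refine (hE.condProj_ae_eq (memLp_centered μ v)).trans ?_
  refine Filter.EventuallyEq.trans (Filter.Eventually.of_forall fun x => ?_)
    (memLp_centered μ ⟨_, hmem⟩).coeFn_toLp.symm
  have h1 : Integrable (fun y => inner ℝ v.1 y) μ := MemLp.integrable one_le_two v.2
  have h2 : Integrable (fun y => inner ℝ (E.starProjection v.1) y) μ :=
    MemLp.integrable one_le_two hmem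
  simp only [inner_mixProj, inner_sub_left]
  rw [integral_sub (by exact (integrable_const _).add (h1.sub h2)) (integrable_const _),
    integral_add (integrable_const _) (by exact h1.sub h2), integral_sub h1 h2]
  simp only [integral_const, probReal_univ, one_smul]
  ring

end Linear

/-! ### Spectral bound for the averaged operator. -/

theorem average_symmetric {n : ℕ} {μ : Measure (EuclideanSpace ℝ (Fin n))}
    {ξ : Measure (Submodule ℝ (EuclideanSpace ℝ (Fin n)))} {T : Lp ℝ 2 μ →L[ℝ] Lp ℝ 2 μ}
    (hT : ∀ f g, inner ℝ (T f) g = ∫ E, inner ℝ (condProj μ E f) g ∂ξ) (f g : Lp ℝ 2 μ) :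
    inner ℝ (T f) g = inner ℝ f (T g) := by
  rw [hT, real_inner_comm, hT]
  congr 1
  ext1 E
  rw [inner_condProj_left, real_inner_comm]

section Average

variable {n : ℕ} {μ : Measure (EuclideanSpace ℝ (Fin n))} [IsProbabilityMeasure μ]
  {ξ : Measure (Submodule ℝ (EuclideanSpace ℝ (Fin n)))} [IsProbabilityMeasure ξ] {lam : ℝ}
  {T : Lp ℝ 2 μ →L[ℝ] Lp ℝ 2 μ}

theorem average_centeredProj (hsplit : SplitsWrt μ ξ)
    (hT : ∀ f g, inner ℝ (T f) g = ∫ E, inner ℝ (condProj μ E f) g ∂ξ)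
    (w : EuclideanSpace ℝ (Fin n)) :
    T (centeredProj μ w) = centeredProj μ
      ((∫ E : Submodule ℝ (EuclideanSpace ℝ (Fin n)), E.starProjection ∂ξ)
        ((linSpace μ).starProjection w)) := by
  refine ext_inner_right ℝ fun g => ?_
  set z := (linSpace μ).orthogonalProjectionOnto w
  have hint := (integrable_starProjection (ξ := ξ)).apply_continuousLinearMap z.1
  rw [← centeredProj_starProjection, Submodule.starProjection_apply, centeredProj_coe, hT,
    ContinuousLinearMap.integral_apply integrable_starProjection,
    ← ContinuousLinearMap.integral_comp_comm _ hint, real_inner_comm,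
    ← integral_inner ((centeredProj μ).integrable_comp hint)]
  refine integral_congr_ae ?_
  filter_upwards [hsplit] with E hE
  rw [hE.condProj_centeredLin, real_inner_comm]

/-- The coefficient vectors contract in the Euclidean norm, which controls the `L²` norm only up to
a constant. The iterate criterion removes that constant. -/
theorem norm_average_centeredProj_le (hframe : FrameBound ξ lam) (hr : 0 ≤ 1 - lam)
    (hsplit : SplitsWrt μ ξ)
    (hT : ∀ f g, inner ℝ (T f) g = ∫ E, inner ℝ (condProj μ E f) g ∂ξ)
    (w : EuclideanSpace ℝ (Fin n)) :
    ‖T (centeredProj μ w)‖ ≤ (1 - lam) * ‖centeredProj μ w‖ := by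
  refine norm_apply_le_of_iterate_decay T (average_symmetric hT) hr _
    ((‖centeredProj μ‖ * ‖w‖) ^ 2) fun k => ?_
  have hk : ∃ z, (T ^ k) (centeredProj μ w) = centeredProj μ z ∧ ‖z‖ ≤ (1 - lam) ^ k * ‖w‖ := by
    induction k with
    | zero => exact ⟨w, by simp, by simp⟩
    | succ k ih =>
      obtain ⟨z, hz, hzw⟩ := ih
      refine ⟨_, by rw [T.pow_succ_apply', hz, average_centeredProj hsplit hT], ?_⟩
      refine (hframe.norm_integral_apply_le hr _).trans ?_
      rw [pow_succ', mul_assoc]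
      gcongr
      exact (Submodule.norm_starProjection_apply_le _ _).trans hzw
  obtain ⟨z, hz, hzw⟩ := hk
  rw [hz, ← mul_pow]
  gcongr
  calc ‖centeredProj μ z‖ ≤ ‖centeredProj μ‖ * ‖z‖ := ContinuousLinearMap.le_opNorm _ _
    _ ≤ ‖centeredProj μ‖ * ((1 - lam) ^ k * ‖w‖) := by gcongr
    _ = _ := by ring

/-- Since `‖T ^ k g‖² = ⟨T ^ (2k) g, g⟩`, the same `g` supplies the initial wave bound and the test
function for Fourier inversion. Closedness extends the contraction to the closure. -/
theorem norm_average_test_le (hframe : FrameBound ξ lam) (hr : 0 ≤ 1 - lam)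
    (hsplit : SplitsWrt μ ξ)
    (hT : ∀ f g, inner ℝ (T f) g = ∫ E, inner ℝ (condProj μ E f) g ∂ξ)
    {f : Lp ℝ 2 μ} (hf : f ∈ (affineFreeTest μ).topologicalClosure) :
    ‖T f‖ ≤ (1 - lam) * ‖f‖ := by
  have hclosed : IsClosed {f : Lp ℝ 2 μ | ‖T f‖ ≤ (1 - lam) * ‖f‖} :=
    isClosed_le T.continuous.norm (continuous_const.mul continuous_norm)
  refine closure_minimal (fun f hf => ?_) hclosed hf
  obtain ⟨g, rfl, h0, h1⟩ := exists_test_of_mem_affineFreeTest hf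
  obtain ⟨K, hK0, hK⟩ := exists_waveBound_toLp g.2.1.continuous g.2.2 μ h0 h1
  obtain ⟨A, hA⟩ := exists_inner_le_of_waveBound g.2.1 g.2.2 μ
  have hwave : ∀ k : ℕ, WaveBound ((T ^ k) (testToLp μ g)) ((1 - lam) ^ k * K) := by
    intro k
    induction k with
    | zero => rw [pow_zero, pow_zero, one_mul]; exact hK
    | succ k ih =>
      rw [T.pow_succ_apply', pow_succ', mul_assoc]
      exact ih.average hframe hsplit hT (by positivity)
  refine norm_apply_le_of_iterate_decay T (average_symmetric hT) hr _ (A * K) fun k => ?_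
  have hkk : (T ^ k) ((T ^ k) (testToLp μ g)) = (T ^ (k + k)) (testToLp μ g) := by
    rw [pow_add]
    rfl
  rw [← real_inner_self_eq_norm_sq, ← T.inner_pow_left_of_symmetric (average_symmetric hT), hkk]
  refine (inner_toLp_eq_integral _ (memLp_testSpace μ g)).trans_le ((hA _ _ (hwave _)).trans ?_)
  rw [pow_add]
  exact le_of_eq (by ring)

theorem inner_average_self_le_of_nonneg (hframe : FrameBound ξ lam) (hr : 0 ≤ 1 - lam)
    (hsplit : SplitsWrt μ ξ)
    (hT : ∀ f g, inner ℝ (T f) g = ∫ E, inner ℝ (condProj μ E f) g ∂ξ)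
    {f : Lp ℝ 2 μ} (hf : ∫ x, f x ∂μ = 0) :
    inner ℝ (T f) f ≤ (1 - lam) * ‖f‖ ^ 2 := by
  obtain ⟨g, hg, l, hl, rfl⟩ :=
    (affineFreeTest μ).topologicalClosure.exists_add_mem_mem_orthogonal f
  rw [Submodule.orthogonal_closure] at hl
  have hgo : ∀ z ∈ (affineFreeTest μ)ᗮ, inner ℝ g z = 0 := fun z hz => by
    rw [← Submodule.orthogonal_closure] at hz
    exact (Submodule.mem_orthogonal _ _).1 hz g hg
  have hgi : Integrable g μ := (Lp.memLp g).integrable one_le_two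
  have hli : Integrable l μ := (Lp.memLp l).integrable one_le_two
  -- Constants lie in the complement, so `g` is centered, and with `f` so is `l`. This excludes the
  -- constants, which `T` fixes.
  have hg0 : ∫ x, g x ∂μ = 0 := by
    have hone : MemLp (fun _ : EuclideanSpace ℝ (Fin n) => (1 : ℝ)) 2 μ := memLp_const 1
    have h1 := hgo (hone.toLp _) ((Submodule.mem_orthogonal _ _).2 fun u hu => by
      obtain ⟨k, rfl, h0, -⟩ := exists_test_of_mem_affineFreeTest hu
      rw [inner_toLp_eq_integral, ← h0]
      refine integral_congr_ae ?_
      filter_upwards [(memLp_testSpace μ k).coeFn_toLp] with x hx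
      rw [mul_one]
      exact hx)
    rw [inner_toLp_eq_integral] at h1
    simpa using h1
  have hl0 : ∫ x, l x ∂μ = 0 := by
    rw [integral_congr_ae (Lp.coeFn_add g l)] at hf
    have := integral_add hgi hli
    simp only [Pi.add_apply] at hf
    linarith
  obtain ⟨c, v, hcv⟩ := ae_eq_affine_of_mem_orthogonal hl
  have hv : v ∈ linSpace μ := by
    have h1 : MemLp (fun x => l x - c) 2 μ := (Lp.memLp l).sub (memLp_const c)
    refine h1.ae_eq ?_
    filter_upwards [hcv] with x hx
    rw [hx]
    ring
  have hlv : l = centeredProj μ v := by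
    rw [centeredProj_coe μ ⟨v, hv⟩]
    apply Lp.ext
    refine hcv.trans (Filter.EventuallyEq.trans (Filter.Eventually.of_forall fun x => ?_)
      (memLp_centered μ ⟨v, hv⟩).coeFn_toLp.symm)
    rw [integral_congr_ae hcv, integral_add (integrable_const c)
      (MemLp.integrable one_le_two hv)] at hl0
    simp at hl0
    simp only
    linarith
  have hTg := norm_average_test_le hframe hr hsplit hT hg
  have hTl : ‖T l‖ ≤ (1 - lam) * ‖l‖ := by
    rw [hlv]
    exact norm_average_centeredProj_le hframe hr hsplit hT v
  -- `T l` is again a centered linear functional, so the cross terms vanish.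
  have hgl : inner ℝ g (T l) = 0 := by
    rw [hlv, average_centeredProj hsplit hT]
    exact hgo _ (centeredProj_mem_orthogonal _)
  have hgl' : inner ℝ g l = 0 := hgo l hl
  have h1 : inner ℝ (T g) g ≤ (1 - lam) * ‖g‖ ^ 2 := by
    nlinarith [real_inner_le_norm (T g) g, mul_le_mul_of_nonneg_right hTg (norm_nonneg g)]
  have h2 : inner ℝ (T l) l ≤ (1 - lam) * ‖l‖ ^ 2 := by
    nlinarith [real_inner_le_norm (T l) l, mul_le_mul_of_nonneg_right hTl (norm_nonneg l)]
  rw [norm_add_sq_real, map_add, inner_add_left, inner_add_right, inner_add_right,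
    average_symmetric hT g l, real_inner_comm g (T l), hgl, hgl']
  linarith

theorem inner_average_self_le (hframe : FrameBound ξ lam) (hsplit : SplitsWrt μ ξ)
    (hT : ∀ f g, inner ℝ (T f) g = ∫ E, inner ℝ (condProj μ E f) g ∂ξ)
    {f : Lp ℝ 2 μ} (hf : ∫ x, f x ∂μ = 0) :
    inner ℝ (T f) f ≤ (1 - lam) * ‖f‖ ^ 2 := by
  rcases le_or_gt 0 (1 - lam) with hr | hr
  · exact inner_average_self_le_of_nonneg hframe hr hsplit hT hf
  -- A negative `1 - lam` is possible only on the zero space, where a centered function vanishes.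
  have hzero : ∀ u : EuclideanSpace ℝ (Fin n), u = 0 := fun u => by
    have h1 := hframe.integral_norm_sq_le u
    have h2 : 0 ≤ ∫ E : Submodule ℝ (EuclideanSpace ℝ (Fin n)), ‖E.starProjection u‖ ^ 2 ∂ξ :=
      integral_nonneg fun E => by positivity
    by_contra hu
    have h3 : 0 < ‖u‖ ^ 2 := pow_pos (norm_pos_iff.2 hu) 2
    nlinarith
  have hfx : ∀ x, f x = f 0 := fun x => by rw [hzero x]
  simp only [hfx, integral_const, probReal_univ, one_smul] at hf
  have hf0 : f = 0 := by
    apply Lp.ext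
    filter_upwards [Lp.coeFn_zero ℝ 2 μ] with x hx
    rw [hx, hfx, hf, Pi.zero_apply]
  simp [hf0]

end Average

/-! ### Variances as Hilbert space norms, and the theorem. -/

section Variance

variable {n : ℕ} {Ω : Type*} [MeasurableSpace Ω] {P : Measure Ω} [IsProbabilityMeasure P]
  {X : Ω → EuclideanSpace ℝ (Fin n)} {f : EuclideanSpace ℝ (Fin n) → ℝ}

theorem norm_toLp_sub_integral_sq {S : Type*} [MeasurableSpace S] {μ : Measure S}
    [IsProbabilityMeasure μ] {f : S → ℝ} (hf : MemLp f 2 μ)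
    (h0 : MemLp (fun x => f x - ∫ y, f y ∂μ) 2 μ) :
    ‖h0.toLp _‖ ^ 2 = Var[f; μ] := by
  rw [variance_eq_integral hf.aemeasurable, ← real_inner_self_eq_norm_sq, inner_toLp_eq_integral]
  refine integral_congr_ae ?_
  filter_upwards [h0.coeFn_toLp] with x hx
  rw [hx, pow_two]

/-- `Var(𝔼[f(X) | P_E X])` is the squared norm of the projection of the centered function. -/
theorem varCondExp_eq_norm_sq (hX : Measurable X) (hf : MemLp f 2 (P.map X))
    (h0 : MemLp (fun x => f x - ∫ y, f y ∂(P.map X)) 2 (P.map X))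
    (E : Submodule ℝ (EuclideanSpace ℝ (Fin n))) :
    varCondExp P X f E = ‖condProj (P.map X) E (h0.toLp _)‖ ^ 2 := by
  have : IsProbabilityMeasure (P.map X) := Measure.isProbabilityMeasure_map hX.aemeasurable
  have hfi : Integrable f (P.map X) := hf.integrable one_le_two
  have hσ : sigmaProj X E = (sigmaProj id E).comap X := by
    rw [MeasurableSpace.comap_comp]
    rfl
  have hle := sigmaProj_id_le E
  have hce : AEMeasurable ((P.map X)[f | sigmaProj id E]) (P.map X) :=
    integrable_condExp.aestronglyMeasurable.aemeasurable
  rw [varCondExp, hσ, variance_congr (condExp_comp_ae_eq _ P hX hle hfi)]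
  have hmap : Var[fun ω => ((P.map X)[f | sigmaProj id E]) (X ω); P]
      = Var[(P.map X)[f | sigmaProj id E]; P.map X] :=
    (variance_map hce hX.aemeasurable).symm
  rw [hmap, variance_eq_integral hce, integral_condExp hle, ← real_inner_self_eq_norm_sq,
    L2.inner_def]
  refine integral_congr_ae ?_
  have h1 : (P.map X)[fun x => f x - ∫ y, f y ∂(P.map X) | sigmaProj id E] =ᵐ[P.map X]
      (P.map X)[f | sigmaProj id E] - fun _ => ∫ y, f y ∂(P.map X) := by
    refine (condExp_sub hfi (integrable_const _) _).trans ?_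
    rw [condExp_const hle]
  filter_upwards [h1, condProj_toLp_ae_eq E h0] with x hx1 hx2
  rw [hx2, hx1]
  simp [pow_two]

theorem expCondVar_eq_sub (hX : Measurable X) (hf : MemLp (fun ω => f (X ω)) 2 P)
    (E : Submodule ℝ (EuclideanSpace ℝ (Fin n))) :
    expCondVar P X f E = Var[fun ω => f (X ω); P] - varCondExp P X f E := by
  have hle : sigmaProj X E ≤ ‹MeasurableSpace Ω› := Measurable.comap_le (by fun_prop)
  have := integral_condVar_add_variance_condExp hle hf
  rw [expCondVar, varCondExp]
  linarith

end Variance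

theorem theorem4 {n : ℕ}
    (μ : Measure (EuclideanSpace ℝ (Fin n))) [IsProbabilityMeasure μ]
    (ξ : Measure (Submodule ℝ (EuclideanSpace ℝ (Fin n)))) [IsProbabilityMeasure ξ]
    (lam : ℝ) (hlam : 0 ≤ lam) (hframe : FrameBound ξ lam) (hsplit : SplitsWrt μ ξ)
    {Ω : Type*} [MeasurableSpace Ω] (P : Measure Ω) [IsProbabilityMeasure P]
    (X : Ω → EuclideanSpace ℝ (Fin n)) (hX : Measurable X) (hXμ : P.map X = μ)
    (f : EuclideanSpace ℝ (Fin n) → ℝ) (hf : MemLp f 2 μ) :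
    -- both integrals over the space of subspaces are well defined
    Integrable (fun E => varCondExp P X f E) ξ ∧
    Integrable (fun E => expCondVar P X f E) ξ ∧
    -- the first inequality
    ∫ E, varCondExp P X f E ∂ξ ≤ (1 - lam) * Var[fun ω => f (X ω); P] ∧
    -- the second inequality
    (0 < lam → Var[fun ω => f (X ω); P] ≤ (1 / lam) * ∫ E, expCondVar P X f E ∂ξ) ∧
    -- the two inequalities are equivalent, for any constant `c > 0` in place of `lam`
    (∀ c : ℝ, 0 < c →
      (∫ E, varCondExp P X f E ∂ξ ≤ (1 - c) * Var[fun ω => f (X ω); P] ↔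
        Var[fun ω => f (X ω); P] ≤ (1 / c) * ∫ E, expCondVar P X f E ∂ξ)) := by
  subst hXμ
  have hfX : MemLp (fun ω => f (X ω)) 2 P := hf.comp_of_map hX.aemeasurable
  have h0 : MemLp (fun x => f x - ∫ y, f y ∂(P.map X)) 2 (P.map X) := hf.sub (memLp_const _)
  obtain ⟨hint, T, hT⟩ := exists_weak_average ξ (condProj (P.map X)) norm_condProj_apply_le
    (aestronglyMeasurable_inner_condProj hsplit)
  have hvar : Var[fun ω => f (X ω); P] = ‖h0.toLp _‖ ^ 2 := by
    rw [norm_toLp_sub_integral_sq hf, variance_map hf.aemeasurable hX.aemeasurable]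
    rfl
  -- A quadratic form of a projection: the square becomes linear in `condProj`, so its `ξ`-average
  -- is the form of `T`.
  have hvc : ∀ E, varCondExp P X f E
      = inner ℝ (condProj (P.map X) E (h0.toLp _)) (h0.toLp _) := fun E => by
    rw [varCondExp_eq_norm_sq hX hf h0, inner_condProj_self]
  have hI1 : Integrable (fun E => varCondExp P X f E) ξ := by
    simp only [hvc]
    exact hint _ _
  have hI2 : Integrable (fun E => expCondVar P X f E) ξ := by
    simp only [expCondVar_eq_sub hX hfX]
    exact (integrable_const _).sub hI1
  have hsum : ∫ E, expCondVar P X f E ∂ξ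
      = Var[fun ω => f (X ω); P] - ∫ E, varCondExp P X f E ∂ξ := by
    simp only [expCondVar_eq_sub hX hfX]
    rw [integral_sub (integrable_const _) hI1]
    simp
  have hmean : ∫ x, h0.toLp _ x ∂(P.map X) = 0 := by
    rw [integral_congr_ae h0.coeFn_toLp,
      integral_sub (hf.integrable one_le_two) (integrable_const _)]
    simp
  have hmain : ∫ E, varCondExp P X f E ∂ξ ≤ (1 - lam) * Var[fun ω => f (X ω); P] := by
    simp only [hvc]
    rw [← hT, hvar]
    exact inner_average_self_le hframe hsplit hT hmean
  have hequiv : ∀ c : ℝ, 0 < c →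
      (∫ E, varCondExp P X f E ∂ξ ≤ (1 - c) * Var[fun ω => f (X ω); P] ↔
        Var[fun ω => f (X ω); P] ≤ (1 / c) * ∫ E, expCondVar P X f E ∂ξ) := fun c hc => by
    rw [hsum, one_div, inv_mul_eq_div, le_div_iff₀ hc]
    constructor <;> intro h <;> linarith
  exact ⟨hI1, hI2, hmain, fun hl => (hequiv lam hl).1 hmain, hequiv⟩
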